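/- Let $d>2$ be an integer, let $J=(d-1)/2$, and let $\{|J,m\rangle : m=J,J-1,\dots,-J\}$ be the standard orthonormal basis of $\mathbb{C}^d$. Let $J_x=\tfrac12(J_++J_-)$ and $J_y=\tfrac1{2i}(J_+-J_-)$ be the spin-$J$ generators of rotations, where $J_+|J,m\rangle=\sqrt{J(J+1)-m(m+1)}\,|J,m+1\rangle$ and $J_-=J_+^\dagger$. For integers $0\le k\le d-1$ and $-k\le q\le k$ let $$T^{(k)}_q=\sqrt{\frac{2k+1}{2J+1}}\sum_m\langle J,m+q\,|\,k,q;J,m\rangle\,|J,m+q\rangle\langle J,m|$$ be the irreducible spherical tensor operators, where $\langle j,m\,|\,j_1,m_1;j_2,m_2\rangle$ are the Clebsch–Gordan coefficients. For a set $S$ of Hermitian $d\times d$ matrices let $\{S\}_{L.A.}$ denote the real Lie algebra generated by the matrices $iH$, $H\in S$, and let $\mathfrak{su}(d)$ be the real Lie algebra of traceless skew-Hermitian $d\times d$ matrices. Then: 1. $\{J_x,J_y,T^{(2)}_0\}_{L.A.}=\mathfrak{su}(d)$. 2. If $h$ is a traceless Hermitian $d\times d$ matrix with $\operatorname{Tr}\bigl(h\,T^{(2)}_q\bigr)\neq0$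 for at least one $q\in\{-2,-1,0,1,2\}$, then $\{J_x,J_y,h\}_{L.A.}=\mathfrak{su}(d)$. -/

import Mathlib

-- The Lie bracket of matrices is the commutator.
attribute [local instance 100] LieRing.ofAssociativeRing

noncomputable section

namespace SpinControl

/-- The reciprocal factorial `1 / x!` of an integer `x` (given as a real number), with the usual
convention that it vanishes for negative `x`. -/
def invFactorial (x : ℝ) : ℝ :=
  if 0 ≤ x then 1 / (Nat.factorial ⌊x⌋₊ : ℝ) else 0

/-- The factorial `x!` of a nonnegative integer `x` (given as a real number). -/
def factorial (x : ℝ) : ℝ := (Nat.factorial ⌊x⌋₊ : ℝ)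

/-- The Clebsch-Gordan coefficient `⟨j, m | j₁, m₁; j₂, m₂⟩` (Condon-Shortley phase convention),
given by Racah's closed formula. The spins are integers or half-integers and each `jᵢ - mᵢ` is
an integer. -/
def clebschGordan (j₁ m₁ j₂ m₂ j m : ℝ) : ℝ :=
  if m = m₁ + m₂ ∧ |m₁| ≤ j₁ ∧ |m₂| ≤ j₂ ∧ |m| ≤ j ∧ |j₁ - j₂| ≤ j ∧ j ≤ j₁ + j₂ then
    √((2 * j + 1) * factorial (j + j₁ - j₂) * factorial (j - j₁ + j₂) * factorial (j₁ + j₂ - j)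
        / factorial (j₁ + j₂ + j + 1)) *
    √(factorial (j + m) * factorial (j - m) * factorial (j₁ - m₁) * factorial (j₁ + m₁)
        * factorial (j₂ - m₂) * factorial (j₂ + m₂)) *
    ∑ s ∈ Finset.range (⌊j₁ + j₂ - j⌋₊ + 1),
      (-1 : ℝ) ^ s * (invFactorial s * invFactorial (j₁ + j₂ - j - s) * invFactorial (j₁ - m₁ - s)
        * invFactorial (j₂ + m₂ - s) * invFactorial (j - j₂ + m₁ + s)
        * invFactorial (j - j₁ - m₂ + s))
  else 0

/-- The spin `J = (d - 1) / 2` whose irreducible representation has dimension `d = 2 J + 1`. -/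
def spin (d : ℕ) : ℝ := ((d : ℝ) - 1) / 2

/-- The magnetic quantum number of the `a`-th basis vector: the basis `|J, m⟩` is ordered as
`m = J, J - 1, …, -J`. -/
def magnetic (d : ℕ) (a : Fin d) : ℝ := spin d - (a : ℕ)

/-- The raising operator: `J₊ |J, m⟩ = √(J (J + 1) - m (m + 1)) |J, m + 1⟩`. -/
def Jplus (d : ℕ) : Matrix (Fin d) (Fin d) ℂ :=
  Matrix.of fun a b =>
    if magnetic d a = magnetic d b + 1 then
      ((√(spin d * (spin d + 1) - magnetic d b * (magnetic d b + 1)) : ℝ) : ℂ)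
    else 0

/-- The lowering operator, the adjoint of the raising operator. -/
def Jminus (d : ℕ) : Matrix (Fin d) (Fin d) ℂ := (Jplus d).conjTranspose

/-- The spin operator `J_x = (J₊ + J₋) / 2`. -/
def Jx (d : ℕ) : Matrix (Fin d) (Fin d) ℂ := (1 / 2 : ℂ) • (Jplus d + Jminus d)

/-- The spin operator `J_y = (J₊ - J₋) / (2 i)`. -/
def Jy (d : ℕ) : Matrix (Fin d) (Fin d) ℂ := (1 / (2 * Complex.I)) • (Jplus d - Jminus d)

/-- The irreducible spherical tensor operator
`T^{(k)}_q = √((2 k + 1) / (2 J + 1)) ∑_m ⟨J, m + q | k, q; J, m⟩ |J, m + q⟩⟨J, m|`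
on the `d`-dimensional space of spin `J`. The Clebsch-Gordan coefficient in the entry at row `a`
and column `b` vanishes unless the magnetic number of `a` is that of `b` plus `q`. -/
def sphericalTensor (d k : ℕ) (q : ℤ) : Matrix (Fin d) (Fin d) ℂ :=
  Matrix.of fun a b =>
    ((√((2 * (k : ℝ) + 1) / (2 * spin d + 1)) *
      clebschGordan k q (spin d) (magnetic d b) (spin d) (magnetic d a) : ℝ) : ℂ)

/-- The real Lie algebra `su(d)` of traceless skew-Hermitian `d × d` matrices. -/
def su (d : ℕ) : LieSubalgebra ℝ (Matrix (Fin d) (Fin d) ℂ) where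
  carrier := {A | A.conjTranspose = -A ∧ A.trace = 0}
  add_mem' := by
    rintro A B ⟨hA, hA'⟩ ⟨hB, hB'⟩
    refine ⟨?_, ?_⟩
    · rw [Matrix.conjTranspose_add, hA, hB, neg_add]
    · rw [Matrix.trace_add, hA', hB', add_zero]
  zero_mem' := by simp
  smul_mem' := by
    rintro c A ⟨hA, hA'⟩
    refine ⟨?_, ?_⟩
    · rw [Matrix.conjTranspose_smul, hA, star_trivial, smul_neg]
    · rw [Matrix.trace_smul, hA', smul_zero]
  lie_mem' := by
    rintro A B ⟨hA, -⟩ ⟨hB, -⟩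
    refine ⟨?_, ?_⟩
    · rw [Ring.lie_def, Matrix.conjTranspose_sub, Matrix.conjTranspose_mul,
        Matrix.conjTranspose_mul, hA, hB]
      noncomm_ring
    · rw [Ring.lie_def, Matrix.trace_sub, Matrix.trace_mul_comm, sub_self]

/-- The Lie algebra generated by a set `S` of Hamiltonians (Hermitian matrices): the smallest real
Lie algebra of matrices that contains `i H` for every `H ∈ S`. -/
def generatedLieAlgebra {d : ℕ} (S : Set (Matrix (Fin d) (Fin d) ℂ)) :
    LieSubalgebra ℝ (Matrix (Fin d) (Fin d) ℂ) :=
  LieSubalgebra.lieSpan ℝ (Matrix (Fin d) (Fin d) ℂ) ((fun H => Complex.I • H) '' S)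

end SpinControl

end

namespace SpinControl

/-! ### Matrix entries of the spin operators -/

/-! Let `L` be the generated real algebra. It lies in `su d`, so it suffices that its complex span
`M = L + iL` contains every traceless matrix (`eq_su_of_complexSpan`). `M` is a complex Lie algebra
closed under adjoints, and it contains `J₊`, `J₋`, `J_z`.

Under commutators with these three, the matrix space is a representation of the rotation algebra.
The matrices killed by `ad J₊` are the polynomials in `J₊` (`exists_eq_sum_smul_Jplus_pow`), and the
Casimir operator takes the value `k(k+1)` on `J₊^k`. The `T^{(2)}_q` are multiples of successive
lowerings of `J₊²`, hence Casimir eigenvectors for 6. The Casimir operator is symmetric for the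
trace form, so if `h` is not trace-orthogonal to some `T^{(2)}_q`, it has a nonzero component in the
generalized eigenspace for 6. That component lies in `M`, and raising it as far as possible gives a
multiple of `J₊²` (`Jplus_sq_mem`).

From `J₊` and `J₊²`, brackets and adjoints produce all positive powers of `J₊` and `J₋`. A highest
weight argument on the trace-annihilator of `M` then shows that it contains only scalars
(`mem_of_trace_eq_zero`). The first claim is the case `h = T^{(2)}_0`, since `tr (T T†) ≠ 0`. -/

/-- The operator `J_z`, diagonal in the standard basis. -/
noncomputable def Jz (d : ℕ) : Matrix (Fin d) (Fin d) ℂ :=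
  Matrix.diagonal fun a => ((magnetic d a : ℝ) : ℂ)

/-- The matrix element of `J₊` between the `b`-th basis vector and its upper neighbour. -/
noncomputable def ladder (d b : ℕ) : ℝ := √((b : ℝ) * ((d : ℝ) - b))

theorem ladder_pos {d b : ℕ} (hb : 0 < b) (hbd : b < d) : 0 < ladder d b := by
  have h1 : (0 : ℝ) < b := by exact_mod_cast hb
  have h2 : (b : ℝ) < d := by exact_mod_cast hbd
  exact Real.sqrt_pos.2 (mul_pos h1 (by linarith))

theorem ladder_mul_self {d b : ℕ} (hbd : b ≤ d) :
    ladder d b * ladder d b = (b : ℝ) * ((d : ℝ) - b) := by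
  have h2 : (b : ℝ) ≤ d := by exact_mod_cast hbd
  exact Real.mul_self_sqrt (mul_nonneg (Nat.cast_nonneg b) (by linarith))

theorem magnetic_eq_add_int_iff {d : ℕ} (a b : Fin d) (q : ℤ) :
    magnetic d a = magnetic d b + q ↔ ((a : ℕ) : ℤ) + q = (b : ℕ) := by
  unfold magnetic
  constructor
  · intro h
    have : (((a : ℕ) : ℤ) + q : ℝ) = ((b : ℕ) : ℤ) := by push_cast; linarith
    exact_mod_cast this
  · intro h
    have : (((a : ℕ) : ℤ) + q : ℝ) = ((b : ℕ) : ℤ) := by exact_mod_cast h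
    push_cast at this
    linarith

/-- Since the index is `b = J - m` and `d = 2J + 1`, one has `J(J+1) - m(m+1) = (J-m)(J+m+1) =
b(d-b)`; raising `m` lowers the index. -/
theorem Jplus_apply {d : ℕ} (a b : Fin d) :
    Jplus d a b = if (a : ℕ) + 1 = b then ((ladder d b : ℝ) : ℂ) else 0 := by
  have h : magnetic d a = magnetic d b + 1 ↔ (a : ℕ) + 1 = b := by
    have := magnetic_eq_add_int_iff a b 1
    push_cast at this
    rw [this]; omega
  simp only [Jplus, Matrix.of_apply, h, ladder]
  split_ifs
  · congr 3
    unfold magnetic spin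
    ring
  · rfl

theorem Jminus_apply {d : ℕ} (a b : Fin d) :
    Jminus d a b = if (b : ℕ) + 1 = a then ((ladder d a : ℝ) : ℂ) else 0 := by
  rw [Jminus, Matrix.conjTranspose_apply, Jplus_apply]
  split_ifs <;> simp

theorem Jplus_mul_apply {d : ℕ} (X : Matrix (Fin d) (Fin d) ℂ) (a b : Fin d) :
    (Jplus d * X) a b =
      if h : (a : ℕ) + 1 < d then ((ladder d (a + 1) : ℝ) : ℂ) * X ⟨a + 1, h⟩ b else 0 := by
  rw [Matrix.mul_apply]
  split_ifs with h
  · rw [Finset.sum_eq_single ⟨(a : ℕ) + 1, h⟩]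
    · simp [Jplus_apply]
    · intro c _ hc
      rw [Jplus_apply, if_neg, zero_mul]
      exact fun e => hc (Fin.ext e.symm)
    · simp
  · refine Finset.sum_eq_zero fun c _ => ?_
    rw [Jplus_apply, if_neg, zero_mul]
    have := c.2
    omega

theorem Jminus_mul_apply {d : ℕ} (X : Matrix (Fin d) (Fin d) ℂ) (a b : Fin d) :
    (Jminus d * X) a b =
      if h : 0 < (a : ℕ) then ((ladder d a : ℝ) : ℂ) * X ⟨a - 1, by omega⟩ b else 0 := by
  rw [Matrix.mul_apply]
  split_ifs with h
  · rw [Finset.sum_eq_single ⟨(a : ℕ) - 1, by omega⟩]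
    · rw [Jminus_apply, if_pos]
      simp only
      omega
    · intro c _ hc
      rw [Jminus_apply, if_neg, zero_mul]
      intro e
      apply hc
      ext
      simp only
      omega
    · simp
  · refine Finset.sum_eq_zero fun c _ => ?_
    rw [Jminus_apply, if_neg, zero_mul]
    omega

theorem Jplus_mul_Jminus (d : ℕ) :
    Jplus d * Jminus d =
      Matrix.diagonal fun a : Fin d => ((((a : ℕ) + 1 : ℝ) * ((d : ℝ) - ((a : ℕ) + 1)) : ℝ) : ℂ) := by
  ext a b
  rw [Jplus_mul_apply, Matrix.diagonal_apply]
  split_ifs with h1 h2 h2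
  · subst h2
    rw [Jminus_apply, if_pos rfl, ← Complex.ofReal_mul]
    simp only
    rw [ladder_mul_self h1.le]
    push_cast; rfl
  · rw [Jminus_apply, if_neg, mul_zero]
    simp only
    exact fun e => h2 (Fin.ext (by omega))
  · have : (d : ℝ) = (a : ℕ) + 1 := by
      have : d = (a : ℕ) + 1 := by have := a.2; omega
      exact_mod_cast this
    rw [← this]; simp
  · rfl

theorem Jminus_mul_Jplus (d : ℕ) :
    Jminus d * Jplus d =
      Matrix.diagonal fun a : Fin d => ((((a : ℕ) : ℝ) * ((d : ℝ) - (a : ℕ)) : ℝ) : ℂ) := by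
  ext a b
  rw [Jminus_mul_apply, Matrix.diagonal_apply]
  split_ifs with h1 h2 h2
  · subst h2
    rw [Jplus_apply, if_pos, ← Complex.ofReal_mul, ladder_mul_self a.2.le]
    simp only
    omega
  · rw [Jplus_apply, if_neg, mul_zero]
    simp only
    exact fun e => h2 (Fin.ext (by omega))
  · have : (a : ℕ) = 0 := by omega
    simp [this]
  · rfl

theorem lie_Jplus_Jminus (d : ℕ) : ⁅Jplus d, Jminus d⁆ = (2 : ℂ) • Jz d := by
  rw [Ring.lie_def, Jplus_mul_Jminus, Jminus_mul_Jplus, Matrix.diagonal_sub, Jz,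
    ← Matrix.diagonal_smul]
  congr 1
  ext a
  simp only [Pi.smul_apply, smul_eq_mul, magnetic, spin]
  push_cast
  ring

theorem lie_Jz_Jplus (d : ℕ) : ⁅Jz d, Jplus d⁆ = Jplus d := by
  ext a b
  rw [Ring.lie_def, Jz, Matrix.sub_apply, Matrix.diagonal_mul, Matrix.mul_diagonal, Jplus_apply]
  split_ifs with h
  · have : ((b : ℕ) : ℂ) = (a : ℕ) + 1 := by exact_mod_cast h.symm
    simp only [magnetic]
    push_cast
    rw [this]; ring
  · simp

theorem lie_Jz_Jminus (d : ℕ) : ⁅Jz d, Jminus d⁆ = -Jminus d := by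
  ext a b
  rw [Ring.lie_def, Jz, Matrix.sub_apply, Matrix.diagonal_mul, Matrix.mul_diagonal,
    Matrix.neg_apply, Jminus_apply]
  split_ifs with h
  · have : ((a : ℕ) : ℂ) = (b : ℕ) + 1 := by exact_mod_cast h.symm
    simp only [magnetic]
    push_cast
    rw [this]; ring
  · simp

/-! ### The tensor operators of rank two -/

theorem factorial_natCast (n : ℕ) : factorial (n : ℝ) = n.factorial := by
  simp [factorial]

theorem invFactorial_natCast (n : ℕ) : invFactorial (n : ℝ) = 1 / n.factorial := by
  simp [invFactorial]

theorem invFactorial_of_neg {x : ℝ} (hx : x < 0) : invFactorial x = 0 := by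
  simp [invFactorial, not_le.2 hx]

/-- The form `n / n!` also covers `n = 0`, so the entries of the tensors at the edge of the matrix
need no separate case. -/
theorem invFactorial_natCast_sub_one (n : ℕ) :
    invFactorial ((n : ℝ) - 1) = n / n.factorial := by
  cases n with
  | zero => rw [invFactorial_of_neg] <;> simp
  | succ n =>
    have h : (n.factorial : ℝ) ≠ 0 := by exact_mod_cast n.factorial_ne_zero
    have h' : (n : ℝ) + 1 ≠ 0 := by positivity
    rw [Nat.cast_succ, add_sub_cancel_right, invFactorial_natCast, Nat.factorial_succ]
    push_cast
    field_simp

theorem invFactorial_natCast_sub_two (n : ℕ) :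
    invFactorial ((n : ℝ) - 2) = n * (n - 1) / n.factorial := by
  cases n with
  | zero => rw [invFactorial_of_neg] <;> norm_num
  | succ n =>
    have h : (n.factorial : ℝ) ≠ 0 := by exact_mod_cast n.factorial_ne_zero
    have h' : (n : ℝ) + 1 ≠ 0 := by positivity
    rw [show ((n + 1 : ℕ) : ℝ) - 2 = n - 1 by push_cast; ring, invFactorial_natCast_sub_one,
      Nat.factorial_succ]
    push_cast
    field_simp
    ring

/-- The factor of the Clebsch-Gordan coefficients of `T^{(2)}_q` that does not depend on the
matrix entry. -/
noncomputable def tensorScale (d : ℕ) : ℝ :=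
  √((2 * ((2 : ℕ) : ℝ) + 1) / (2 * spin d + 1)) *
    √((2 * spin d + 1) * factorial (spin d + (2 : ℕ) - spin d) *
      factorial (spin d - (2 : ℕ) + spin d) * factorial ((2 : ℕ) + spin d - spin d)
        / factorial ((2 : ℕ) + spin d + spin d + 1))

theorem factorial_pos (x : ℝ) : 0 < factorial x := by
  unfold factorial
  exact_mod_cast Nat.factorial_pos _

theorem tensorScale_pos {d : ℕ} (hd : 2 < d) : 0 < tensorScale d := by
  have h : 0 < 2 * spin d + 1 := by
    have : (2 : ℝ) < d := by exact_mod_cast hd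
    unfold spin; linarith
  have := factorial_pos
  unfold tensorScale
  refine mul_pos (Real.sqrt_pos.2 (by positivity)) (Real.sqrt_pos.2 ?_)
  exact div_pos (mul_pos (mul_pos (mul_pos h (this _)) (this _)) (this _)) (this _)

theorem sphericalTensor_two_apply_of_ne {d : ℕ} (q : ℤ) (a b : Fin d)
    (h : ((a : ℕ) : ℤ) + q ≠ (b : ℕ)) : sphericalTensor d 2 q a b = 0 := by
  have h' : ¬ magnetic d a = q + magnetic d b := by
    rw [add_comm, magnetic_eq_add_int_iff]; exact h
  simp [sphericalTensor, clebschGordan, h']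

/-- The entries of `T^{(2)}_q`, in terms of the numbers `a = J - m'`, `a' = J + m'`, `b = J - m`
and `b' = J + m`. -/
theorem sphericalTensor_two_apply {d : ℕ} (hd : 2 < d) (q : ℤ) (hq : |q| ≤ 2) (a b : Fin d)
    (a' b' : ℕ) (ha : (a : ℕ) + a' + 1 = d) (hb : (b : ℕ) + b' + 1 = d)
    (h : ((a : ℕ) : ℤ) + q = (b : ℕ)) :
    sphericalTensor d 2 q a b = ((tensorScale d *
      (√((a'.factorial : ℝ) * (a : ℕ).factorial * factorial (2 - q) * factorial (2 + q)
        * (b : ℕ).factorial * b'.factorial) *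
      (invFactorial (2 - q) * invFactorial b' * invFactorial q * invFactorial ((b : ℕ) - 2) / 2
      - invFactorial (2 - q - 1) * invFactorial (b' - 1) * invFactorial (q + 1)
          * invFactorial ((b : ℕ) - 1)
      + invFactorial (2 - q - 2) * invFactorial (b' - 2) * invFactorial (q + 2)
          * invFactorial (b : ℕ) / 2)) : ℝ) : ℂ) := by
  have hJ : spin d + spin d = (a : ℕ) + a' := by
    have : (d : ℝ) = (a : ℕ) + a' + 1 := by exact_mod_cast ha.symm
    unfold spin; linarith
  have hJ' : spin d + spin d = (b : ℕ) + b' := by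
    have : (d : ℝ) = (b : ℕ) + b' + 1 := by exact_mod_cast hb.symm
    unfold spin; linarith
  have hJ1 : 1 ≤ spin d := by
    have : (3 : ℝ) ≤ d := by exact_mod_cast hd
    unfold spin; linarith
  have hm : magnetic d a = q + magnetic d b := by
    rw [add_comm, magnetic_eq_add_int_iff]; exact h
  have hqr : |(q : ℝ)| ≤ 2 := by exact_mod_cast hq
  have h0 : ∀ n : ℕ, (0 : ℝ) ≤ n := fun n => Nat.cast_nonneg n
  have hma : |magnetic d a| ≤ spin d := by
    unfold magnetic
    rw [abs_le]; constructor <;> linarith [h0 a, h0 a']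
  have hmb : |magnetic d b| ≤ spin d := by
    unfold magnetic
    rw [abs_le]; constructor <;> linarith [h0 b, h0 b']
  have h2J : |(2 : ℝ) - spin d| ≤ spin d := by
    rw [abs_le]; constructor <;> linarith
  -- For rank two, Racah's sum has only the terms `s = 0, 1, 2`.
  have hfl : ⌊(2 : ℝ) + spin d - spin d⌋₊ = 2 := by
    rw [add_sub_cancel_right]; norm_num
  have e1 : spin d + magnetic d a = a' := by unfold magnetic; linarith
  have e2 : spin d - magnetic d a = (a : ℕ) := by unfold magnetic; linarith
  have e3 : spin d + magnetic d b = b' := by unfold magnetic; linarith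
  have e4 : spin d - magnetic d b = (b : ℕ) := by unfold magnetic; linarith
  have e5 : spin d - 2 - magnetic d b = (b : ℕ) - 2 := by linarith
  have i0 : invFactorial 0 = 1 := by simpa using invFactorial_natCast 0
  have i1 : invFactorial 1 = 1 := by simpa using invFactorial_natCast 1
  have i2 : invFactorial 2 = 1 / 2 := by simpa using invFactorial_natCast 2
  rw [sphericalTensor, Matrix.of_apply, clebschGordan, if_pos]
  swap
  · push_cast
    exact ⟨hm, hqr, hmb, hma, h2J, by linarith⟩
  push_cast
  rw [hfl, e1, e2, e3, e4, e5]
  simp only [factorial_natCast, Finset.sum_range_succ, Finset.sum_range_zero, zero_add,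
    Nat.cast_zero, Nat.cast_one, Nat.cast_ofNat, add_sub_cancel_right, sub_self, zero_add,
    i0, i1, i2, add_zero, sub_zero, show (2 : ℝ) - 1 = 1 by norm_num, add_sub_cancel_left,
    tensorScale]
  rw [show ((b : ℕ) : ℝ) - 2 + 1 = (b : ℕ) - 1 by ring, sub_add_cancel]
  push_cast
  ring

theorem sqrt_mul_sq_of_nonneg {k l : ℝ} (hl : 0 ≤ l) (hk : 0 ≤ k) : √(k * (l * l)) = √k * l := by
  rw [Real.sqrt_mul hk, Real.sqrt_mul_self hl]

theorem ladder_nonneg (d b : ℕ) : 0 ≤ ladder d b := Real.sqrt_nonneg _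

theorem sphericalTensor_two_two {d : ℕ} (hd : 2 < d) :
    ∃ c : ℂ, sphericalTensor d 2 2 = c • Jplus d ^ 2 := by
  refine ⟨((tensorScale d * (√24 / 4) : ℝ) : ℂ), ?_⟩
  ext ⟨a, ha⟩ ⟨b, hb⟩
  rw [Matrix.smul_apply, sq, Jplus_mul_apply, smul_eq_mul]
  by_cases h : a + 2 = b
  · obtain ⟨c, rfl⟩ : ∃ c, d = a + c + 3 := ⟨d - (a + 3), by omega⟩
    subst h
    rw [sphericalTensor_two_apply hd 2 (by norm_num) _ _ (c + 2) c (by simp only; omega)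
      (by simp only; omega) (by simp), dif_pos (by simp only; omega), Jplus_apply, if_pos rfl]
    have l1 := ladder_mul_self (d := a + c + 3) (b := a + 1) (by omega)
    have l2 := ladder_mul_self (d := a + c + 3) (b := a + 2) (by omega)
    have p1 := ladder_nonneg (a + c + 3) (a + 1)
    have p2 := ladder_nonneg (a + c + 3) (a + 2)
    set x := ladder (a + c + 3) (a + 1)
    set y := ladder (a + c + 3) (a + 2)
    have fa : (a.factorial : ℝ) ≠ 0 := by exact_mod_cast a.factorial_ne_zero
    have fc : (c.factorial : ℝ) ≠ 0 := by exact_mod_cast c.factorial_ne_zero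
    have f0 : factorial 0 = 1 := by simpa using factorial_natCast 0
    have f4 : factorial 4 = 24 := by simpa [Nat.factorial] using factorial_natCast 4
    have i0 : invFactorial 0 = 1 := by simpa using invFactorial_natCast 0
    have i2 : invFactorial 2 = 1 / 2 := by simpa using invFactorial_natCast 2
    have n1 : invFactorial (-1) = 0 := invFactorial_of_neg (by norm_num)
    have n2 : invFactorial (-2) = 0 := invFactorial_of_neg (by norm_num)
    -- The squared ladder elements are `(a+1)(c+2)` and `(a+2)(c+1)`, exactly the factorial ratios
    -- that make the radicand 24 times a square. Only the term `s = 0` survives, which gives the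
    -- factor 1/4.
    have hs : ((c + 2).factorial : ℝ) * a.factorial * 1 * 24 * (a + 2).factorial * c.factorial =
        24 * ((a.factorial * c.factorial * (x * y)) * (a.factorial * c.factorial * (x * y))) := by
      rw [show 24 * ((a.factorial * c.factorial * (x * y)) * (a.factorial * c.factorial * (x * y)))
        = 24 * (a.factorial * c.factorial) ^ 2 * ((x * x) * (y * y)) by ring, l1, l2,
        Nat.factorial_succ, Nat.factorial_succ, Nat.factorial_succ, Nat.factorial_succ]
      push_cast
      ring
    rw [← Complex.ofReal_mul, ← Complex.ofReal_mul]
    congr 1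
    push_cast
    norm_num [-Real.sqrt_mul', -Real.sqrt_mul, -Nat.cast_nonneg]
    rw [f0, f4, hs, sqrt_mul_sq_of_nonneg (by positivity) (by norm_num), i0, i2, n1, n2,
      invFactorial_natCast, invFactorial_natCast]
    field_simp
    ring
  · rw [sphericalTensor_two_apply_of_ne _ _ _ (by simp only; omega)]
    split_ifs with h'
    · rw [Jplus_apply, if_neg (by simp only; omega)]; simp
    · simp

theorem sphericalTensor_two_one {d : ℕ} (hd : 2 < d) :
    ∃ c : ℂ, sphericalTensor d 2 1 = c • (Jz d * Jplus d + Jplus d * Jz d) := by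
  refine ⟨((-(tensorScale d * (√6 / 2)) : ℝ) : ℂ), ?_⟩
  ext ⟨a, ha⟩ ⟨b, hb⟩
  rw [Matrix.smul_apply, Matrix.add_apply, Jz, Matrix.diagonal_mul, Matrix.mul_diagonal,
    smul_eq_mul, Jplus_apply]
  by_cases h : a + 1 = b
  · obtain ⟨c, rfl⟩ : ∃ c, d = a + c + 2 := ⟨d - (a + 2), by omega⟩
    subst h
    rw [sphericalTensor_two_apply hd 1 (by norm_num) _ _ (c + 1) c (by simp only; omega)
      (by simp only; omega) (by simp), if_pos rfl]
    have l1 := ladder_mul_self (d := a + c + 2) (b := a + 1) (by omega)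
    have p1 := ladder_nonneg (a + c + 2) (a + 1)
    simp only [magnetic, spin]
    set x := ladder (a + c + 2) (a + 1)
    have fa : (a.factorial : ℝ) ≠ 0 := by exact_mod_cast a.factorial_ne_zero
    have fc : (c.factorial : ℝ) ≠ 0 := by exact_mod_cast c.factorial_ne_zero
    have f1 : factorial 1 = 1 := by simpa using factorial_natCast 1
    have f3 : factorial 3 = 6 := by simpa [Nat.factorial] using factorial_natCast 3
    have i0 : invFactorial 0 = 1 := by simpa using invFactorial_natCast 0
    have i1 : invFactorial 1 = 1 := by simpa using invFactorial_natCast 1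
    have i2 : invFactorial 2 = 1 / 2 := by simpa using invFactorial_natCast 2
    have n1 : invFactorial (-1) = 0 := invFactorial_of_neg (by norm_num)
    have ea := invFactorial_natCast_sub_one a
    have ec := invFactorial_natCast_sub_one c
    have hs : ((c + 1).factorial : ℝ) * a.factorial * 1 * 6 * (a + 1).factorial * c.factorial =
        6 * ((a.factorial * c.factorial * x) * (a.factorial * c.factorial * x)) := by
      rw [show 6 * ((a.factorial * c.factorial * x) * (a.factorial * c.factorial * x))
        = 6 * (a.factorial * c.factorial) ^ 2 * (x * x) by ring, l1,
        Nat.factorial_succ, Nat.factorial_succ]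
      push_cast
      ring
    rw [← Complex.ofReal_mul, ← Complex.ofReal_mul, ← Complex.ofReal_add, ← Complex.ofReal_mul]
    congr 1
    push_cast
    rw [show (a : ℝ) + 1 - 2 = a - 1 by ring, show (a : ℝ) + 1 - 1 = a by ring]
    norm_num [-Real.sqrt_mul', -Real.sqrt_mul, -Nat.cast_nonneg]
    rw [f1, f3, hs, sqrt_mul_sq_of_nonneg (by positivity) (by norm_num), i0, i1, i2, n1,
      invFactorial_natCast, invFactorial_natCast, ea, ec]
    field_simp
    ring
  · rw [sphericalTensor_two_apply_of_ne _ _ _ (by simp only; omega),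
      if_neg (by simp only; omega)]
    simp

/-- The scalar is explicit, unlike for the other components, because this one must also be shown to
be nonzero. -/
theorem sphericalTensor_two_zero {d : ℕ} (hd : 2 < d) :
    sphericalTensor d 2 0 = ((-(tensorScale d / 2) : ℝ) : ℂ) •
      (Jplus d * Jminus d + Jminus d * Jplus d - (4 : ℂ) • (Jz d * Jz d)) := by
  rw [Jplus_mul_Jminus, Jminus_mul_Jplus, Jz, Matrix.diagonal_mul_diagonal, Matrix.diagonal_add,
    ← Matrix.diagonal_smul, Matrix.diagonal_sub, ← Matrix.diagonal_smul]
  ext ⟨a, ha⟩ ⟨b, hb⟩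
  rw [Matrix.diagonal_apply]
  by_cases h : a = b
  · obtain ⟨c, rfl⟩ : ∃ c, d = a + c + 1 := ⟨d - (a + 1), by omega⟩
    subst h
    rw [sphericalTensor_two_apply hd 0 (by norm_num) _ _ c c (by simp only)
      (by simp only) (by simp), if_pos rfl]
    simp only [magnetic, spin, Pi.smul_apply, smul_eq_mul]
    have fa : (a.factorial : ℝ) ≠ 0 := by exact_mod_cast a.factorial_ne_zero
    have fc : (c.factorial : ℝ) ≠ 0 := by exact_mod_cast c.factorial_ne_zero
    have f2 : factorial 2 = 2 := by simpa using factorial_natCast 2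
    have i0 : invFactorial 0 = 1 := by simpa using invFactorial_natCast 0
    have i1 : invFactorial 1 = 1 := by simpa using invFactorial_natCast 1
    have i2 : invFactorial 2 = 1 / 2 := by simpa using invFactorial_natCast 2
    have ea := invFactorial_natCast_sub_one a
    have ec := invFactorial_natCast_sub_one c
    have ea' := invFactorial_natCast_sub_two a
    have ec' := invFactorial_natCast_sub_two c
    have hs : √((c.factorial : ℝ) * a.factorial * 2 * 2 * a.factorial * c.factorial) =
        2 * (a.factorial * c.factorial) := by
      rw [show ((c.factorial : ℝ) * a.factorial * 2 * 2 * a.factorial * c.factorial) =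
        (2 * (a.factorial * c.factorial)) * (2 * (a.factorial * c.factorial)) by ring,
        Real.sqrt_mul_self (by positivity)]
    rw [← Complex.ofReal_mul, ← Complex.ofReal_add, ← Complex.ofReal_ofNat, ← Complex.ofReal_mul,
      ← Complex.ofReal_sub, ← Complex.ofReal_mul]
    congr 1
    push_cast
    norm_num [-Real.sqrt_mul', -Real.sqrt_mul, -Nat.cast_nonneg]
    rw [f2, hs, i0, i1, i2, invFactorial_natCast, invFactorial_natCast, ea, ec, ea', ec']
    field_simp
    ring
  · rw [sphericalTensor_two_apply_of_ne _ _ _ (by simp only; omega), if_neg (by simpa using h)]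

theorem sphericalTensor_two_neg_one {d : ℕ} (hd : 2 < d) :
    ∃ c : ℂ, sphericalTensor d 2 (-1) = c • (Jz d * Jminus d + Jminus d * Jz d) := by
  refine ⟨((tensorScale d * (√6 / 2) : ℝ) : ℂ), ?_⟩
  ext ⟨a, ha⟩ ⟨b, hb⟩
  rw [Matrix.smul_apply, Matrix.add_apply, Jz, Matrix.diagonal_mul, Matrix.mul_diagonal,
    smul_eq_mul, Jminus_apply]
  by_cases h : b + 1 = a
  · obtain ⟨c, rfl⟩ : ∃ c, d = b + c + 2 := ⟨d - (b + 2), by omega⟩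
    subst h
    rw [sphericalTensor_two_apply hd (-1) (by norm_num) _ _ c (c + 1) (by simp only; omega)
      (by simp only; omega) (by simp), if_pos rfl]
    have l1 := ladder_mul_self (d := b + c + 2) (b := b + 1) (by omega)
    have p1 := ladder_nonneg (b + c + 2) (b + 1)
    simp only [magnetic, spin]
    set x := ladder (b + c + 2) (b + 1)
    have fa : (b.factorial : ℝ) ≠ 0 := by exact_mod_cast b.factorial_ne_zero
    have fc : (c.factorial : ℝ) ≠ 0 := by exact_mod_cast c.factorial_ne_zero
    have f1 : factorial 1 = 1 := by simpa using factorial_natCast 1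
    have f3 : factorial 3 = 6 := by simpa [Nat.factorial] using factorial_natCast 3
    have i0 : invFactorial 0 = 1 := by simpa using invFactorial_natCast 0
    have i1 : invFactorial 1 = 1 := by simpa using invFactorial_natCast 1
    have i2 : invFactorial 2 = 1 / 2 := by simpa using invFactorial_natCast 2
    have n1 : invFactorial (-1) = 0 := invFactorial_of_neg (by norm_num)
    have ea := invFactorial_natCast_sub_one b
    have ec := invFactorial_natCast_sub_one c
    have hs : (c.factorial : ℝ) * (b + 1).factorial * 6 * 1 * b.factorial * (c + 1).factorial =
        6 * ((b.factorial * c.factorial * x) * (b.factorial * c.factorial * x)) := by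
      rw [show 6 * ((b.factorial * c.factorial * x) * (b.factorial * c.factorial * x))
        = 6 * (b.factorial * c.factorial) ^ 2 * (x * x) by ring, l1,
        Nat.factorial_succ, Nat.factorial_succ]
      push_cast
      ring
    rw [← Complex.ofReal_mul, ← Complex.ofReal_mul, ← Complex.ofReal_add, ← Complex.ofReal_mul]
    congr 1
    push_cast
    rw [show (c : ℝ) + 1 - 2 = c - 1 by ring, show (c : ℝ) + 1 - 1 = c by ring]
    norm_num [-Real.sqrt_mul', -Real.sqrt_mul, -Nat.cast_nonneg]
    rw [f1, f3, hs, sqrt_mul_sq_of_nonneg (by positivity) (by norm_num), i0, i1, i2, n1,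
      invFactorial_natCast, invFactorial_natCast, ea, ec]
    field_simp
    ring
  · rw [sphericalTensor_two_apply_of_ne _ _ _ (by simp only; omega),
      if_neg (by simp only; omega)]
    simp

theorem sphericalTensor_two_neg_two {d : ℕ} (hd : 2 < d) :
    ∃ c : ℂ, sphericalTensor d 2 (-2) = c • Jminus d ^ 2 := by
  refine ⟨((tensorScale d * (√24 / 4) : ℝ) : ℂ), ?_⟩
  ext ⟨a, ha⟩ ⟨b, hb⟩
  rw [Matrix.smul_apply, sq, Jminus_mul_apply, smul_eq_mul]
  by_cases h : b + 2 = a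
  · obtain ⟨c, rfl⟩ : ∃ c, d = b + c + 3 := ⟨d - (b + 3), by omega⟩
    subst h
    rw [sphericalTensor_two_apply hd (-2) (by norm_num) _ _ c (c + 2) (by simp only; omega)
      (by simp only; omega) (by simp), dif_pos (by simp only; omega), Jminus_apply,
      if_pos (by simp)]
    simp only [show b + 2 - 1 = b + 1 by omega]
    have l1 := ladder_mul_self (d := b + c + 3) (b := b + 1) (by omega)
    have l2 := ladder_mul_self (d := b + c + 3) (b := b + 2) (by omega)
    have p1 := ladder_nonneg (b + c + 3) (b + 1)
    have p2 := ladder_nonneg (b + c + 3) (b + 2)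
    set x := ladder (b + c + 3) (b + 1)
    set y := ladder (b + c + 3) (b + 2)
    have fa : (b.factorial : ℝ) ≠ 0 := by exact_mod_cast b.factorial_ne_zero
    have fc : (c.factorial : ℝ) ≠ 0 := by exact_mod_cast c.factorial_ne_zero
    have f0 : factorial 0 = 1 := by simpa using factorial_natCast 0
    have f4 : factorial 4 = 24 := by simpa [Nat.factorial] using factorial_natCast 4
    have i0 : invFactorial 0 = 1 := by simpa using invFactorial_natCast 0
    have i2 : invFactorial 2 = 1 / 2 := by simpa using invFactorial_natCast 2
    have n1 : invFactorial (-1) = 0 := invFactorial_of_neg (by norm_num)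
    have n2 : invFactorial (-2) = 0 := invFactorial_of_neg (by norm_num)
    have hs : (c.factorial : ℝ) * (b + 2).factorial * 24 * 1 * b.factorial * (c + 2).factorial =
        24 * ((b.factorial * c.factorial * (x * y)) * (b.factorial * c.factorial * (x * y))) := by
      rw [show 24 * ((b.factorial * c.factorial * (x * y)) * (b.factorial * c.factorial * (x * y)))
        = 24 * (b.factorial * c.factorial) ^ 2 * ((x * x) * (y * y)) by ring, l1, l2,
        Nat.factorial_succ, Nat.factorial_succ, Nat.factorial_succ, Nat.factorial_succ]
      push_cast
      ring
    rw [← Complex.ofReal_mul, ← Complex.ofReal_mul]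
    congr 1
    push_cast
    norm_num [-Real.sqrt_mul', -Real.sqrt_mul, -Nat.cast_nonneg]
    rw [f0, f4, hs, sqrt_mul_sq_of_nonneg (by positivity) (by norm_num), i0, i2, n1, n2,
      invFactorial_natCast, invFactorial_natCast]
    field_simp
    ring
  · rw [sphericalTensor_two_apply_of_ne _ _ _ (by simp only; omega)]
    split_ifs with h'
    · rw [Jminus_apply, if_neg (by simp only at h' ⊢; omega)]; simp
    · simp

/-! ### The Casimir operator of the adjoint action -/

/-- Stated in an arbitrary ring because it is applied to the operators `ad J`, not to the spin
matrices. -/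
theorem commute_raise_casimir {A : Type*} [Ring A] {e f h : A} (hef : e * f = f * e + (h + h))
    (heh : e * h = h * e - e) : Commute e (h * h + h + f * e) := by
  unfold Commute SemiconjBy
  linear_combination (norm := noncomm_ring) heh * h + h * heh + hef * e

theorem commute_lower_casimir {A : Type*} [Ring A] {e f h : A} (hef : e * f = f * e + (h + h))
    (hhf : h * f = f * h - f) : Commute f (h * h + h + f * e) := by
  unfold Commute SemiconjBy
  linear_combination (norm := noncomm_ring) -(hhf * h) - h * hhf - f * hef

theorem Jplus_mul_Jminus_comm (d : ℕ) :
    Jplus d * Jminus d = Jminus d * Jplus d + (Jz d + Jz d) := by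
  have := lie_Jplus_Jminus d
  rw [Ring.lie_def, two_smul] at this
  rw [← this]; abel

theorem Jplus_mul_Jz (d : ℕ) : Jplus d * Jz d = Jz d * Jplus d - Jplus d := by
  have := lie_Jz_Jplus d
  rw [Ring.lie_def] at this
  nth_rewrite 3 [← this]; abel

theorem Jz_mul_Jminus (d : ℕ) : Jz d * Jminus d = Jminus d * Jz d - Jminus d := by
  have := lie_Jz_Jminus d
  rw [Ring.lie_def, sub_eq_iff_eq_add] at this
  rw [this]; abel

/-- The commutator with `A`, as a linear endomorphism of the matrices. -/
noncomputable abbrev adj {d : ℕ} (A : Matrix (Fin d) (Fin d) ℂ) :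
    Module.End ℂ (Matrix (Fin d) (Fin d) ℂ) :=
  LieAlgebra.ad ℂ (Matrix (Fin d) (Fin d) ℂ) A

/-- The Casimir operator of the rotation algebra acting on matrices by commutators. -/
noncomputable def casimir (d : ℕ) : Module.End ℂ (Matrix (Fin d) (Fin d) ℂ) :=
  adj (Jz d) * adj (Jz d) + adj (Jz d) + adj (Jminus d) * adj (Jplus d)

theorem adj_mul_adj {d : ℕ} (A B : Matrix (Fin d) (Fin d) ℂ) :
    adj A * adj B = adj B * adj A + adj ⁅A, B⁆ := by
  rw [adj, adj, adj, LieHom.map_lie, Ring.lie_def]; abel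

theorem adj_Jplus_mul_adj_Jminus (d : ℕ) :
    adj (Jplus d) * adj (Jminus d) =
      adj (Jminus d) * adj (Jplus d) + (adj (Jz d) + adj (Jz d)) := by
  rw [adj_mul_adj, lie_Jplus_Jminus, two_smul]
  simp only [adj, map_add]

theorem commute_adj_Jplus_casimir (d : ℕ) : Commute (adj (Jplus d)) (casimir d) := by
  refine commute_raise_casimir (adj_Jplus_mul_adj_Jminus d) ?_
  rw [adj_mul_adj, ← lie_skew, lie_Jz_Jplus]
  simp only [adj, map_neg, sub_eq_add_neg]

theorem commute_adj_Jminus_casimir (d : ℕ) : Commute (adj (Jminus d)) (casimir d) := by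
  refine commute_lower_casimir (adj_Jplus_mul_adj_Jminus d) ?_
  rw [adj_mul_adj, lie_Jz_Jminus]
  simp only [adj, map_neg, sub_eq_add_neg]

theorem casimir_apply {d : ℕ} (X : Matrix (Fin d) (Fin d) ℂ) :
    casimir d X = ⁅Jz d, ⁅Jz d, X⁆⁆ + ⁅Jz d, X⁆ + ⁅Jminus d, ⁅Jplus d, X⁆⁆ := rfl

theorem trace_lie_mul {d : ℕ} (X A B : Matrix (Fin d) (Fin d) ℂ) :
    (⁅X, A⁆ * B).trace = -(A * ⁅X, B⁆).trace := by
  rw [Ring.lie_def, Ring.lie_def, sub_mul, mul_sub, Matrix.trace_sub, Matrix.trace_sub,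
    ← mul_assoc A B X, Matrix.trace_mul_comm (A * B) X, mul_assoc, mul_assoc]
  ring

/-- Each `ad` is skew for the trace form, so transposition reverses `ad J₋ ad J₊` and negates `ad
J_z`; the `2 ad J_z` from reordering restores the sign. -/
theorem trace_casimir_mul {d : ℕ} (A B : Matrix (Fin d) (Fin d) ℂ) :
    (casimir d A * B).trace = (A * casimir d B).trace := by
  have h : ⁅Jplus d, ⁅Jminus d, B⁆⁆ = ⁅Jminus d, ⁅Jplus d, B⁆⁆ + (⁅Jz d, B⁆ + ⁅Jz d, B⁆) :=
    congrArg (fun f => f B) (adj_Jplus_mul_adj_Jminus d)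
  rw [casimir_apply, casimir_apply]
  simp only [add_mul, mul_add, Matrix.trace_add, trace_lie_mul, neg_neg, h]
  ring

theorem lie_Jz_Jplus_pow (d k : ℕ) : ⁅Jz d, Jplus d ^ k⁆ = (k : ℂ) • Jplus d ^ k := by
  induction k with
  | zero => simp [Ring.lie_def]
  | succ k ih =>
    rw [Ring.lie_def, sub_eq_iff_eq_add] at ih
    have h := Jplus_mul_Jz d
    rw [Ring.lie_def, pow_succ, ← mul_assoc, ih, mul_assoc (Jplus d ^ k), h]
    simp only [add_mul, mul_sub, mul_assoc, smul_mul_assoc]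
    push_cast
    rw [add_smul, one_smul]
    abel

theorem lie_Jplus_Jplus_pow (d k : ℕ) : ⁅Jplus d, Jplus d ^ k⁆ = 0 := by
  rw [Ring.lie_def, ← pow_succ', ← pow_succ, sub_self]

theorem casimir_Jplus_pow (d k : ℕ) :
    casimir d (Jplus d ^ k) = ((k : ℂ) * (k + 1)) • Jplus d ^ k := by
  rw [casimir_apply, lie_Jplus_Jplus_pow, lie_Jz_Jplus_pow, lie_smul, lie_Jz_Jplus_pow, lie_zero]
  module

theorem casimir_lie_Jminus {d : ℕ} {X : Matrix (Fin d) (Fin d) ℂ} {c : ℂ}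
    (hX : casimir d X = c • X) : casimir d ⁅Jminus d, X⁆ = c • ⁅Jminus d, X⁆ := by
  have h : ⁅Jminus d, casimir d X⁆ = casimir d ⁅Jminus d, X⁆ :=
    congrArg (fun f => f X) (commute_adj_Jminus_casimir d).eq
  rw [← h, hX, lie_smul]

/-- This and the next three lemmas descend from `J₊²` to `J₋²`, passing through all five rank-two
operators up to scalars. -/
theorem lie_Jminus_Jplus_sq (d : ℕ) :
    ⁅Jminus d, Jplus d ^ 2⁆ = (-2 : ℂ) • (Jz d * Jplus d + Jplus d * Jz d) := by
  have h := Jplus_mul_Jminus_comm d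
  rw [Ring.lie_def, neg_smul, two_smul]
  linear_combination (norm := noncomm_ring) -(h * Jplus d) - Jplus d * h

theorem lie_Jminus_rank_two_one (d : ℕ) :
    ⁅Jminus d, Jz d * Jplus d + Jplus d * Jz d⁆ =
      Jplus d * Jminus d + Jminus d * Jplus d - (4 : ℂ) • (Jz d * Jz d) := by
  have h := Jplus_mul_Jminus_comm d
  have h' := Jz_mul_Jminus d
  rw [Ring.lie_def, ofNat_smul_eq_nsmul ℂ 4]
  linear_combination (norm := noncomm_ring)
    -(h' * Jplus d) - Jz d * h - Jplus d * h' - h * Jz d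

theorem lie_Jminus_rank_two_zero (d : ℕ) :
    ⁅Jminus d, Jplus d * Jminus d + Jminus d * Jplus d - (4 : ℂ) • (Jz d * Jz d)⁆ =
      (-6 : ℂ) • (Jz d * Jminus d + Jminus d * Jz d) := by
  have h := Jplus_mul_Jminus_comm d
  have h' := Jz_mul_Jminus d
  rw [Ring.lie_def, neg_smul, ofNat_smul_eq_nsmul ℂ 4, ofNat_smul_eq_nsmul ℂ 6]
  linear_combination (norm := noncomm_ring)
    -(h * Jminus d) - Jminus d * h + 4 * (h' * Jz d) + 4 * (Jz d * h')

theorem lie_Jminus_rank_two_neg_one (d : ℕ) :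
    ⁅Jminus d, Jz d * Jminus d + Jminus d * Jz d⁆ = (2 : ℂ) • Jminus d ^ 2 := by
  have h' := Jz_mul_Jminus d
  rw [Ring.lie_def, two_smul]
  linear_combination (norm := noncomm_ring) -(h' * Jminus d) - Jminus d * h'

theorem casimir_eq_of_smul {d : ℕ} {X Y : Matrix (Fin d) (Fin d) ℂ} {c k : ℂ} (hk : k ≠ 0)
    (h : Y = k • X) (hY : casimir d Y = c • Y) : casimir d X = c • X := by
  subst h
  rw [map_smul, smul_comm] at hY
  exact smul_right_injective _ hk hY

theorem casimir_sphericalTensor_two {d : ℕ} (hd : 2 < d) (q : ℤ) (hq : -2 ≤ q) (hq' : q ≤ 2) :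
    casimir d (sphericalTensor d 2 q) = (6 : ℂ) • sphericalTensor d 2 q := by
  have h2 : casimir d (Jplus d ^ 2) = (6 : ℂ) • Jplus d ^ 2 := by
    rw [casimir_Jplus_pow]; norm_num
  have h1 := casimir_eq_of_smul (by norm_num) (lie_Jminus_Jplus_sq d) (casimir_lie_Jminus h2)
  have h0 := casimir_lie_Jminus h1
  rw [lie_Jminus_rank_two_one] at h0
  have h1' := casimir_eq_of_smul (by norm_num) (lie_Jminus_rank_two_zero d)
    (casimir_lie_Jminus h0)
  have h2' := casimir_eq_of_smul (by norm_num) (lie_Jminus_rank_two_neg_one d)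
    (casimir_lie_Jminus h1')
  have key : ∀ {X : Matrix (Fin d) (Fin d) ℂ}, casimir d X = (6 : ℂ) • X → ∀ {q : ℤ},
      (∃ c : ℂ, sphericalTensor d 2 q = c • X) →
      casimir d (sphericalTensor d 2 q) = (6 : ℂ) • sphericalTensor d 2 q := by
    rintro X hX q ⟨c, hc⟩
    rw [hc, map_smul, hX, smul_comm]
  interval_cases q
  · exact key h2' (sphericalTensor_two_neg_two hd)
  · exact key h1' (sphericalTensor_two_neg_one hd)
  · exact key h0 ⟨_, sphericalTensor_two_zero hd⟩
  · exact key h1 (sphericalTensor_two_one hd)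
  · exact key h2 (sphericalTensor_two_two hd)

/-! ### Highest weight vectors -/

theorem Jplus_pow_apply_of_ne {d : ℕ} (k : ℕ) (a b : Fin d) (h : (a : ℕ) + k ≠ b) :
    (Jplus d ^ k) a b = 0 := by
  induction k generalizing a with
  | zero =>
    rw [pow_zero, Matrix.one_apply_ne]
    exact fun e => h (by simp [e])
  | succ k ih =>
    rw [pow_succ', Jplus_mul_apply]
    split_ifs with h'
    · rw [ih _ (by simp only; omega), mul_zero]
    · rfl

theorem Jplus_pow_apply_ne_zero {d : ℕ} (k : ℕ) (a b : Fin d) (h : (a : ℕ) + k = b) :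
    (Jplus d ^ k) a b ≠ 0 := by
  induction k generalizing a with
  | zero =>
    have : a = b := Fin.ext (by simpa using h)
    simp [this]
  | succ k ih =>
    have hb := b.2
    rw [pow_succ', Jplus_mul_apply, dif_pos (by omega)]
    refine mul_ne_zero ?_ (ih _ (by simp only; omega))
    exact_mod_cast (ladder_pos (Nat.succ_pos _) (by omega)).ne'

theorem isNilpotent_Jplus (d : ℕ) : IsNilpotent (Jplus d) := by
  refine ⟨d, ?_⟩
  ext a b
  exact Jplus_pow_apply_of_ne _ _ _ (by omega)

/-- `ad J₊` is nilpotent because `J₊` is; the last nonzero iterate works. -/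
theorem exists_highest {d : ℕ} {Y : Matrix (Fin d) (Fin d) ℂ} (hY : Y ≠ 0) :
    ∃ n : ℕ, (adj (Jplus d) ^ n) Y ≠ 0 ∧ ⁅Jplus d, (adj (Jplus d) ^ n) Y⁆ = 0 := by
  classical
  obtain ⟨N, hN⟩ := LieAlgebra.ad_nilpotent_of_nilpotent (R := ℂ) (isNilpotent_Jplus d)
  have hex : ∃ n, (adj (Jplus d) ^ n) Y = 0 := ⟨N, by rw [adj, hN]; rfl⟩
  have hpos : Nat.find hex ≠ 0 := by
    intro h
    have := Nat.find_spec hex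
    rw [h] at this
    exact hY this
  obtain ⟨n, hn⟩ := Nat.exists_eq_succ_of_ne_zero hpos
  refine ⟨n, Nat.find_min hex (by omega), ?_⟩
  have := Nat.find_spec hex
  rw [hn, Nat.succ_eq_add_one, pow_succ'] at this
  exact this

theorem sum_smul_Jplus_pow_apply {d : ℕ} (c : ℕ → ℂ) (a b : Fin d) (k : ℕ)
    (h : (a : ℕ) + k = b) :
    (∑ i ∈ Finset.range d, c i • Jplus d ^ i) a b = c k * (Jplus d ^ k) a b := by
  rw [Matrix.sum_apply, Finset.sum_eq_single k]
  · rfl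
  · intro i _ hi
    rw [Matrix.smul_apply, Jplus_pow_apply_of_ne _ _ _ (by omega), smul_zero]
  · intro hk
    have := b.2
    rw [Finset.mem_range] at hk
    omega

theorem eq_zero_of_sum_smul_Jplus_pow_eq_zero {d : ℕ} {c : ℕ → ℂ}
    (h : ∑ i ∈ Finset.range d, c i • Jplus d ^ i = 0) {k : ℕ} (hk : k < d) : c k = 0 := by
  have h0 : (⟨0, by omega⟩ : Fin d).val + k = (⟨k, hk⟩ : Fin d).val := by simp
  have := sum_smul_Jplus_pow_apply c _ _ k h0
  rw [h, Matrix.zero_apply] at this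
  exact (mul_eq_zero.1 this.symm).resolve_right (Jplus_pow_apply_ne_zero k _ _ h0)

/-- The last basis vector is cyclic for `J₊`, so a matrix commuting with `J₊` is determined by its
last column, and a polynomial in `J₊` can match any last column. -/
theorem exists_eq_sum_smul_Jplus_pow {d : ℕ} {X : Matrix (Fin d) (Fin d) ℂ}
    (hX : ⁅Jplus d, X⁆ = 0) : ∃ c : ℕ → ℂ, X = ∑ k ∈ Finset.range d, c k • Jplus d ^ k := by
  rcases Nat.eq_zero_or_pos d with rfl | hd
  · exact ⟨0, Subsingleton.elim _ _⟩
  let l : Fin d := ⟨d - 1, by omega⟩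
  let r : ℕ → Fin d := fun k => ⟨d - 1 - k, by omega⟩
  refine ⟨fun k => X (r k) l / (Jplus d ^ k) (r k) l, ?_⟩
  set c : ℕ → ℂ := fun k => X (r k) l / (Jplus d ^ k) (r k) l with hc
  set S := ∑ k ∈ Finset.range d, c k • Jplus d ^ k with hS
  have hcol : ∀ a, (X - S) a l = 0 := by
    intro a
    have ha : (a : ℕ) + (d - 1 - a) = (l : ℕ) := by simp only [l]; omega
    have hr : r (d - 1 - a) = a := by ext; simp only [r]; omega
    rw [Matrix.sub_apply, hS, sum_smul_Jplus_pow_apply c a l _ ha, hc]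
    simp only [hr]
    rw [div_mul_cancel₀ _ (Jplus_pow_apply_ne_zero _ _ _ ha), sub_self]
  have hcomm : Commute (Jplus d) (X - S) := by
    refine Commute.sub_right ?_ ?_
    · rw [Ring.lie_def, sub_eq_zero] at hX
      exact hX
    · exact Commute.sum_right _ _ _ fun k _ => ((Commute.refl _).pow_right k).smul_right _
  rw [← sub_eq_zero]
  ext a b
  have hb : (b : ℕ) + (d - 1 - b) = (l : ℕ) := by simp only [l]; omega
  -- `J₊^(d-1-b)` carries the last basis vector to a nonzero multiple of the `b`-th; commuting it
  -- past `X - S` reduces column `b` to the vanishing last column.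
  have h1 : ((X - S) * Jplus d ^ (d - 1 - b)) a l = 0 := by
    rw [← (hcomm.pow_left _).eq, Matrix.mul_apply]
    exact Finset.sum_eq_zero fun i _ => by rw [hcol, mul_zero]
  rw [Matrix.mul_apply, Finset.sum_eq_single b] at h1
  · exact (mul_eq_zero.1 h1).resolve_right (Jplus_pow_apply_ne_zero _ _ _ hb)
  · intro i _ hi
    rw [Jplus_pow_apply_of_ne, mul_zero]
    exact fun e => hi (Fin.ext (by omega))
  · simp

/-- An invariant space of matrices that has a member not orthogonal to the eigenspace of the
Casimir operator for rank two contains the highest weight vector of rank two. -/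
theorem Jplus_sq_mem {d : ℕ} (M : Submodule ℂ (Matrix (Fin d) (Fin d) ℂ))
    (hp : ∀ X ∈ M, ⁅Jplus d, X⁆ ∈ M) (hm : ∀ X ∈ M, ⁅Jminus d, X⁆ ∈ M)
    (hz : ∀ X ∈ M, ⁅Jz d, X⁆ ∈ M) {A T : Matrix (Fin d) (Fin d) ℂ} (hA : A ∈ M)
    (hT : casimir d T = (6 : ℂ) • T) (hAT : (A * T).trace ≠ 0) : Jplus d ^ 2 ∈ M := by
  set g : Module.End ℂ (Matrix (Fin d) (Fin d) ℂ) := casimir d - (6 : ℂ) • 1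
  have g_apply : ∀ X, g X = casimir d X - (6 : ℂ) • X := fun X => rfl
  have hgM : ∀ X ∈ M, g X ∈ M := by
    intro X hX
    rw [g_apply, casimir_apply]
    exact M.sub_mem (M.add_mem (M.add_mem (hz _ (hz _ hX)) (hz _ hX)) (hm _ (hp _ hX)))
      (M.smul_mem _ hX)
  have gT : g T = 0 := by rw [g_apply, hT, sub_self]
  have gsymm : ∀ (n : ℕ) (X Y : Matrix (Fin d) (Fin d) ℂ),
      ((g ^ n) X * Y).trace = (X * (g ^ n) Y).trace := by
    intro n
    induction n with
    | zero => intro X Y; rfl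
    | succ n ih =>
      intro X Y
      rw [pow_succ, Module.End.mul_apply, ih, ← pow_succ, pow_succ',
        Module.End.mul_apply, g_apply, g_apply, sub_mul, mul_sub, Matrix.trace_sub,
        Matrix.trace_sub, trace_casimir_mul, smul_mul_assoc, mul_smul_comm]
  -- Fitting decomposition of `M` under `g`, which avoids diagonalizing the Casimir operator. The
  -- bound `n ≥ 1` ensures `g^n T = 0`, so the range part of `A` is trace-orthogonal to `T`.
  obtain ⟨n, hn, hcompl⟩ := ((Filter.eventually_ge_atTop 1).and
    (LinearMap.eventually_isCompl_ker_pow_range_pow (g.restrict hgM))).exists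
  obtain ⟨x, hx, y, hy, hxy⟩ := Submodule.mem_sup.1
    (hcompl.sup_eq_top ▸ Submodule.mem_top : (⟨A, hA⟩ : M) ∈ _)
  obtain ⟨z, rfl⟩ := hy
  rw [LinearMap.mem_ker, Module.End.pow_restrict] at hx
  have hx0 : (g ^ n) (x : Matrix (Fin d) (Fin d) ℂ) = 0 := congrArg Subtype.val hx
  have hAx : A = x + (g ^ n) (z : Matrix (Fin d) (Fin d) ℂ) := by
    have := congrArg Subtype.val hxy
    rw [Module.End.pow_restrict] at this
    exact this.symm
  have hxne : (x : Matrix (Fin d) (Fin d) ℂ) ≠ 0 := by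
    intro h
    apply hAT
    obtain ⟨k, rfl⟩ := Nat.exists_eq_add_of_le' hn
    rw [hAx, h, zero_add, gsymm, pow_succ, Module.End.mul_apply, gT, map_zero, mul_zero,
      Matrix.trace_zero]
  obtain ⟨m, hXne, hX⟩ := exists_highest hxne
  have hXM : (adj (Jplus d) ^ m) (x : Matrix (Fin d) (Fin d) ℂ) ∈ M := by
    clear hXne hX
    induction m with
    | zero => exact x.2
    | succ m ih => rw [pow_succ']; exact hp _ ih
  have hcomm : Commute (adj (Jplus d)) g :=
    (commute_adj_Jplus_casimir d).sub_right ((Commute.one_right _).smul_right _)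
  have hgX : (g ^ n) ((adj (Jplus d) ^ m) (x : Matrix (Fin d) (Fin d) ℂ)) = 0 := by
    rw [← Module.End.mul_apply, ← (hcomm.pow_pow m n).eq, Module.End.mul_apply, hx0, map_zero]
  obtain ⟨c, hc⟩ := exists_eq_sum_smul_Jplus_pow hX
  have gpow : ∀ n k : ℕ, (g ^ n) (Jplus d ^ k) = ((k : ℂ) * (k + 1) - 6) ^ n • Jplus d ^ k := by
    intro n k
    induction n with
    | zero => simp
    | succ n ih =>
      rw [pow_succ', Module.End.mul_apply, ih, map_smul, g_apply, casimir_Jplus_pow, ← sub_smul,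
        smul_smul, pow_succ]
  rw [hc] at hgX hXne hXM
  simp only [map_sum, map_smul, gpow, smul_smul] at hgX
  have hc0 : ∀ k < d, k ≠ 2 → c k = 0 := by
    intro k hk hk2
    refine (mul_eq_zero.1 (eq_zero_of_sum_smul_Jplus_pow_eq_zero
      (c := fun k => c k * ((k : ℂ) * (k + 1) - 6) ^ n) hgX hk)).resolve_right ?_
    refine pow_ne_zero _ fun h => hk2 ?_
    have h' : k * (k + 1) = 6 := by
      rw [sub_eq_zero] at h
      exact_mod_cast h
    have : k ≤ 2 := by nlinarith
    interval_cases k <;> omega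
  have hsum : ∑ k ∈ Finset.range d, c k • Jplus d ^ k = c 2 • Jplus d ^ 2 := by
    rcases lt_or_ge 2 d with h2 | h2
    · refine Finset.sum_eq_single 2 ?_ ?_
      · intro k hk hk2
        rw [hc0 k (Finset.mem_range.1 hk) hk2, zero_smul]
      · intro h
        exact absurd (Finset.mem_range.2 h2) h
    -- If `d ≤ 2`, the index 2 is absent and every coefficient vanishes, contradicting that the
    -- highest weight vector is nonzero.
    · exfalso
      refine hXne (Finset.sum_eq_zero fun k hk => ?_)
      have := Finset.mem_range.1 hk
      rw [hc0 k this (by omega), zero_smul]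
  rw [hsum] at hXne hXM
  have hc2 : c 2 ≠ 0 := fun h => hXne (by rw [h, zero_smul])
  simpa [smul_smul, hc2] using M.smul_mem (c 2)⁻¹ hXM

/-! ### Generation of all traceless matrices -/

theorem Jminus_pow_eq (d k : ℕ) : Jminus d ^ k = (Jplus d ^ k).conjTranspose := by
  rw [Jminus, Matrix.conjTranspose_pow]

theorem trace_Jplus_pow_mul_Jminus_pow_of_ne {d k l : ℕ} (h : k ≠ l) :
    (Jplus d ^ k * Jminus d ^ l).trace = 0 := by
  rw [Matrix.trace]
  refine Finset.sum_eq_zero fun a _ => ?_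
  rw [Matrix.diag_apply, Matrix.mul_apply]
  refine Finset.sum_eq_zero fun b _ => ?_
  rw [Jminus_pow_eq, Matrix.conjTranspose_apply]
  by_cases hk : (a : ℕ) + k = b
  · rw [Jplus_pow_apply_of_ne l a b (by omega), star_zero, mul_zero]
  · rw [Jplus_pow_apply_of_ne k a b hk, zero_mul]

theorem trace_Jplus_pow_mul_Jminus_pow_ne_zero {d k : ℕ} (h : k < d) :
    (Jplus d ^ k * Jminus d ^ k).trace ≠ 0 := by
  open scoped ComplexOrder in
  rw [Jminus_pow_eq, Ne, Matrix.trace_mul_conjTranspose_self_eq_zero_iff]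
  intro h0
  exact Jplus_pow_apply_ne_zero k ⟨0, by omega⟩ ⟨k, h⟩ (by simp) (by rw [h0]; rfl)

theorem exists_eq_trace_mul {d : ℕ} (φ : Matrix (Fin d) (Fin d) ℂ →ₗ[ℂ] ℂ) :
    ∃ Y : Matrix (Fin d) (Fin d) ℂ, ∀ X, φ X = (Y * X).trace := by
  refine ⟨Matrix.of fun i j => φ (Matrix.single j i 1), fun X => ?_⟩
  conv_lhs => rw [Matrix.matrix_eq_sum_single X]
  simp only [map_sum, Matrix.trace, Matrix.diag_apply, Matrix.mul_apply, Matrix.of_apply]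
  rw [Finset.sum_comm]
  refine Finset.sum_congr rfl fun i _ => Finset.sum_congr rfl fun j _ => ?_
  rw [show Matrix.single j i (X j i) = X j i • Matrix.single j i (1 : ℂ) by simp, map_smul,
    smul_eq_mul, mul_comm]

/-- This bracket raises the rank: from `J₊` it generates every higher power. -/
theorem lie_rank_two_one_Jplus_pow (d k : ℕ) :
    ⁅Jz d * Jplus d + Jplus d * Jz d, Jplus d ^ k⁆ = (2 * k : ℂ) • Jplus d ^ (k + 1) := by
  have h := lie_Jz_Jplus_pow d k
  rw [Ring.lie_def, sub_eq_iff_eq_add] at h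
  have hz : Jz d * Jplus d * Jplus d ^ k = (k : ℂ) • Jplus d ^ (k + 1) +
      Jplus d ^ k * (Jz d * Jplus d) := by
    rw [mul_assoc, ← pow_succ', pow_succ, ← mul_assoc, h, add_mul, smul_mul_assoc, mul_assoc]
  have hz' : Jplus d * Jz d * Jplus d ^ k = (k : ℂ) • Jplus d ^ (k + 1) +
      Jplus d ^ k * (Jplus d * Jz d) := by
    rw [mul_assoc, h, mul_add, mul_smul_comm, ← pow_succ', ← mul_assoc, ← mul_assoc, ← pow_succ',
      ← pow_succ]
  rw [Ring.lie_def, add_mul, hz, hz', mul_add]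
  module

theorem mem_of_trace_eq_zero {d : ℕ} (M : Submodule ℂ (Matrix (Fin d) (Fin d) ℂ))
    (hlie : ∀ X ∈ M, ∀ Y ∈ M, ⁅X, Y⁆ ∈ M) (hstar : ∀ X ∈ M, X.conjTranspose ∈ M)
    (hp : Jplus d ∈ M) (hp2 : Jplus d ^ 2 ∈ M) {A : Matrix (Fin d) (Fin d) ℂ}
    (hA : A.trace = 0) : A ∈ M := by
  have hm : Jminus d ∈ M := hstar _ hp
  have hQ : Jz d * Jplus d + Jplus d * Jz d ∈ M := by
    have h := M.smul_mem (-2 : ℂ)⁻¹ (hlie _ hm _ hp2)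
    rwa [lie_Jminus_Jplus_sq, smul_smul, inv_mul_cancel₀ (by norm_num), one_smul] at h
  have hpow : ∀ k : ℕ, Jplus d ^ (k + 1) ∈ M := by
    intro k
    induction k with
    | zero => simpa using hp
    | succ k ih =>
      have h := M.smul_mem (2 * (k + 1 : ℕ) : ℂ)⁻¹ (hlie _ hQ _ ih)
      have hk : (2 * (k + 1 : ℕ) : ℂ) ≠ 0 :=
        mul_ne_zero two_ne_zero (Nat.cast_ne_zero.2 k.succ_ne_zero)
      rwa [lie_rank_two_one_Jplus_pow, smul_smul, inv_mul_cancel₀ hk, one_smul] at h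
  have hmpow : ∀ k : ℕ, Jminus d ^ (k + 1) ∈ M := fun k => by
    rw [Jminus_pow_eq]; exact hstar _ (hpow k)
  by_contra hAM
  obtain ⟨φ, hφA, hφM⟩ := Submodule.exists_le_ker_of_notMem hAM
  obtain ⟨Y, hY⟩ := exists_eq_trace_mul φ
  have hYM : ∀ X ∈ M, (Y * X).trace = 0 := fun X hX => by
    rw [← hY]; exact hφM hX
  have hY0 : Y ≠ 0 := by
    rintro rfl
    exact hφA (by rw [hY, zero_mul, Matrix.trace_zero])
  obtain ⟨n, hne, hZ⟩ := exists_highest hY0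
  -- The annihilator of `M` is stable under `ad J₊`, since `M` is and `ad J₊` is skew for the trace
  -- form.
  have hZM : ∀ n : ℕ, ∀ X ∈ M, ((adj (Jplus d) ^ n) Y * X).trace = 0 := by
    intro n
    induction n with
    | zero => exact hYM
    | succ n ih =>
      intro X hX
      rw [pow_succ', Module.End.mul_apply, LieAlgebra.ad_apply, trace_lie_mul,
        ih _ (hlie _ hp _ hX), neg_zero]
  obtain ⟨c, hc⟩ := exists_eq_sum_smul_Jplus_pow hZ
  have hck : ∀ k < d, k ≠ 0 → c k = 0 := by
    intro k hk hk0
    obtain ⟨l, rfl⟩ := Nat.exists_eq_succ_of_ne_zero hk0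
    have h := hZM n _ (hmpow l)
    rw [hc, Finset.sum_mul, Matrix.trace_sum, Finset.sum_eq_single (l + 1)] at h
    · rw [smul_mul_assoc, Matrix.trace_smul, smul_eq_mul] at h
      exact (mul_eq_zero.1 h).resolve_right (trace_Jplus_pow_mul_Jminus_pow_ne_zero hk)
    · intro i _ hi
      rw [smul_mul_assoc, Matrix.trace_smul, trace_Jplus_pow_mul_Jminus_pow_of_ne hi, smul_zero]
    · intro h'
      exact absurd (Finset.mem_range.2 hk) h'
  have hscalar : (adj (Jplus d) ^ n) Y = c 0 • 1 := by
    rw [hc, Finset.sum_eq_single 0, pow_zero]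
    · intro k hk hk0
      rw [hck k (Finset.mem_range.1 hk) hk0, zero_smul]
    · intro h0
      have : d = 0 := by simpa using h0
      subst this
      exact Subsingleton.elim _ _
  -- Without raising, `Y` itself is scalar and so annihilates the traceless `A`. After a raising,
  -- the result is a nonzero scalar and also a commutator, impossible by trace.
  cases n with
  | zero =>
    have hY1 : Y = c 0 • 1 := hscalar
    rw [hY, hY1, smul_mul_assoc, one_mul, Matrix.trace_smul, hA, smul_zero] at hφA
    exact hφA rfl
  | succ n =>
    have ht : ((adj (Jplus d) ^ (n + 1)) Y).trace = 0 := by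
      rw [pow_succ', Module.End.mul_apply, LieAlgebra.ad_apply, Ring.lie_def, Matrix.trace_sub,
        Matrix.trace_mul_comm, sub_self]
    rw [hscalar, Matrix.trace_smul, Matrix.trace_one, Fintype.card_fin, smul_eq_mul,
      mul_eq_zero] at ht
    rcases ht with h0 | h0
    · rw [hscalar, h0, zero_smul] at hne
      exact hne rfl
    · have : d = 0 := by exact_mod_cast h0
      subst this
      exact hne (Subsingleton.elim _ _)

/-! ### Real Lie algebras of skew-Hermitian matrices -/

/-- The complex span `L + i L` of a real Lie algebra of matrices. -/
noncomputable def complexSpan {d : ℕ} (L : LieSubalgebra ℝ (Matrix (Fin d) (Fin d) ℂ)) :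
    Submodule ℂ (Matrix (Fin d) (Fin d) ℂ) where
  carrier := {A | ∃ B ∈ L, ∃ C ∈ L, A = B + Complex.I • C}
  add_mem' := by
    rintro _ _ ⟨B, hB, C, hC, rfl⟩ ⟨B', hB', C', hC', rfl⟩
    exact ⟨B + B', L.add_mem hB hB', C + C', L.add_mem hC hC', by module⟩
  zero_mem' := ⟨0, L.zero_mem, 0, L.zero_mem, by simp⟩
  smul_mem' := by
    rintro z _ ⟨B, hB, C, hC, rfl⟩
    refine ⟨z.re • B - z.im • C, L.sub_mem (L.smul_mem _ hB) (L.smul_mem _ hC),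
      z.re • C + z.im • B, L.add_mem (L.smul_mem _ hC) (L.smul_mem _ hB), ?_⟩
    ext i j
    simp only [Matrix.smul_apply, Matrix.add_apply, Matrix.sub_apply, smul_eq_mul,
      Complex.real_smul]
    conv_lhs => rw [← Complex.re_add_im z]
    linear_combination (z.im : ℂ) * C i j * Complex.I_mul_I

theorem mem_complexSpan_of_I_smul_mem {d : ℕ} {L : LieSubalgebra ℝ (Matrix (Fin d) (Fin d) ℂ)}
    {A : Matrix (Fin d) (Fin d) ℂ} (h : Complex.I • A ∈ L) : A ∈ complexSpan L :=
  ⟨0, L.zero_mem, -(Complex.I • A), L.neg_mem h, by simp [smul_smul]⟩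

theorem lie_mem_complexSpan {d : ℕ} {L : LieSubalgebra ℝ (Matrix (Fin d) (Fin d) ℂ)} :
    ∀ X ∈ complexSpan L, ∀ Y ∈ complexSpan L, ⁅X, Y⁆ ∈ complexSpan L := by
  rintro _ ⟨B, hB, C, hC, rfl⟩ _ ⟨B', hB', C', hC', rfl⟩
  refine ⟨⁅B, B'⁆ - ⁅C, C'⁆, L.sub_mem (L.lie_mem hB hB') (L.lie_mem hC hC'),
    ⁅B, C'⁆ + ⁅C, B'⁆, L.add_mem (L.lie_mem hB hC') (L.lie_mem hC hB'), ?_⟩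
  simp only [add_lie, lie_add, smul_lie, lie_smul]
  match_scalars <;> simp

theorem conjTranspose_mem_complexSpan {d : ℕ} {L : LieSubalgebra ℝ (Matrix (Fin d) (Fin d) ℂ)}
    (hL : L ≤ su d) : ∀ X ∈ complexSpan L, X.conjTranspose ∈ complexSpan L := by
  rintro _ ⟨B, hB, C, hC, rfl⟩
  refine ⟨-B, L.neg_mem hB, C, hC, ?_⟩
  rw [Matrix.conjTranspose_add, Matrix.conjTranspose_smul, (hL hB).1, (hL hC).1, Complex.star_def,
    Complex.conj_I, smul_neg, neg_smul, neg_neg]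

/-- In `A = B + iC` with `B, C ∈ L`, the term `iC` is Hermitian while `A` and `B` are
skew-Hermitian, so `iC = 0`. -/
theorem eq_su_of_complexSpan {d : ℕ} {L : LieSubalgebra ℝ (Matrix (Fin d) (Fin d) ℂ)}
    (hL : L ≤ su d) (h : ∀ A : Matrix (Fin d) (Fin d) ℂ, A.trace = 0 → A ∈ complexSpan L) :
    L = su d := by
  refine le_antisymm hL fun A hA => ?_
  obtain ⟨B, hB, C, hC, hABC⟩ := h A hA.2
  have h1 := hA.1
  rw [hABC, Matrix.conjTranspose_add, Matrix.conjTranspose_smul, (hL hB).1, (hL hC).1,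
    Complex.star_def, Complex.conj_I, smul_neg, neg_smul, neg_neg, neg_add, add_right_inj] at h1
  have h2 : (2 : ℂ) • (Complex.I • C) = 0 := by
    rw [two_smul]
    nth_rewrite 1 [h1]
    exact neg_add_cancel _
  rw [hABC, (smul_eq_zero.1 h2).resolve_left two_ne_zero, add_zero]
  exact hB

theorem Jx_isHermitian (d : ℕ) : (Jx d).IsHermitian := by
  rw [Matrix.IsHermitian, Jx, Matrix.conjTranspose_smul, Matrix.conjTranspose_add, Jminus,
    Matrix.conjTranspose_conjTranspose, add_comm]
  simp

theorem Jy_isHermitian (d : ℕ) : (Jy d).IsHermitian := by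
  rw [Matrix.IsHermitian, Jy, Matrix.conjTranspose_smul, Matrix.conjTranspose_sub, Jminus,
    Matrix.conjTranspose_conjTranspose, ← neg_sub (Jplus d), smul_neg, ← neg_smul]
  simp

theorem trace_Jplus (d : ℕ) : (Jplus d).trace = 0 := by
  refine Finset.sum_eq_zero fun a _ => ?_
  rw [Matrix.diag_apply, Jplus_apply, if_neg (by omega)]

theorem trace_Jminus (d : ℕ) : (Jminus d).trace = 0 := by
  rw [Jminus, Matrix.trace_conjTranspose, trace_Jplus, star_zero]

theorem I_smul_mem_su {d : ℕ} {A : Matrix (Fin d) (Fin d) ℂ} (hA : A.IsHermitian)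
    (ht : A.trace = 0) : Complex.I • A ∈ su d := by
  refine ⟨?_, ?_⟩
  · rw [Matrix.conjTranspose_smul, hA.eq, Complex.star_def, Complex.conj_I, neg_smul]
  · rw [Matrix.trace_smul, ht, smul_zero]

theorem generatedLieAlgebra_eq_su {d : ℕ} (hd : 2 < d) {h : Matrix (Fin d) (Fin d) ℂ}
    (hh : h.IsHermitian) (ht : h.trace = 0)
    (hq : ∃ q : ℤ, -2 ≤ q ∧ q ≤ 2 ∧ (h * sphericalTensor d 2 q).trace ≠ 0) :
    generatedLieAlgebra {Jx d, Jy d, h} = su d := by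
  obtain ⟨q, hq1, hq2, hq⟩ := hq
  set L := generatedLieAlgebra {Jx d, Jy d, h} with hLdef
  have hgen : ∀ A ∈ ({Jx d, Jy d, h} : Set (Matrix (Fin d) (Fin d) ℂ)), Complex.I • A ∈ L :=
    fun A hA => LieSubalgebra.subset_lieSpan (Set.mem_image_of_mem _ hA)
  have hL : L ≤ su d := by
    rw [hLdef, generatedLieAlgebra, LieSubalgebra.lieSpan_le]
    rintro _ ⟨A, hA, rfl⟩
    rcases hA with rfl | rfl | rfl
    · exact I_smul_mem_su (Jx_isHermitian d) (by simp [Jx, trace_Jplus, trace_Jminus])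
    · exact I_smul_mem_su (Jy_isHermitian d) (by simp [Jy, trace_Jplus, trace_Jminus])
    · exact I_smul_mem_su hh ht
  have hx : Jx d ∈ complexSpan L := mem_complexSpan_of_I_smul_mem (hgen _ (by simp))
  have hy : Jy d ∈ complexSpan L := mem_complexSpan_of_I_smul_mem (hgen _ (by simp))
  have hhM : h ∈ complexSpan L := mem_complexSpan_of_I_smul_mem (hgen _ (by simp))
  have hp : Jplus d ∈ complexSpan L := by
    have hsum : Jplus d = Jx d + Complex.I • Jy d := by
      rw [Jx, Jy, smul_smul, show Complex.I * (1 / (2 * Complex.I)) = 1 / 2 by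
        field_simp [Complex.I_ne_zero]]
      module
    rw [hsum]
    exact Submodule.add_mem _ hx (Submodule.smul_mem _ _ hy)
  have hstar := conjTranspose_mem_complexSpan hL
  have hm : Jminus d ∈ complexSpan L := hstar _ hp
  have hz : Jz d ∈ complexSpan L := by
    have h2 := Submodule.smul_mem _ (2 : ℂ)⁻¹ (lie_mem_complexSpan _ hp _ hm)
    rwa [lie_Jplus_Jminus, smul_smul, inv_mul_cancel₀ two_ne_zero, one_smul] at h2
  have hp2 : Jplus d ^ 2 ∈ complexSpan L :=
    Jplus_sq_mem _ (lie_mem_complexSpan _ hp) (lie_mem_complexSpan _ hm)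
      (lie_mem_complexSpan _ hz) hhM (casimir_sphericalTensor_two hd q hq1 hq2) hq
  exact eq_su_of_complexSpan hL fun A hA =>
    mem_of_trace_eq_zero _ lie_mem_complexSpan hstar hp hp2 hA

theorem trace_casimir {d : ℕ} (X : Matrix (Fin d) (Fin d) ℂ) : (casimir d X).trace = 0 := by
  have h : ∀ A B : Matrix (Fin d) (Fin d) ℂ, ⁅A, B⁆.trace = 0 := fun A B => by
    rw [Ring.lie_def, Matrix.trace_sub, Matrix.trace_mul_comm, sub_self]
  rw [casimir_apply, Matrix.trace_add, Matrix.trace_add, h, h, h, add_zero, add_zero]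

/-- The Casimir operator outputs sums of commutators, and its eigenvalue 6 is nonzero. -/
theorem trace_sphericalTensor_two {d : ℕ} (hd : 2 < d) {q : ℤ} (hq : -2 ≤ q) (hq' : q ≤ 2) :
    (sphericalTensor d 2 q).trace = 0 := by
  have h := congrArg Matrix.trace (casimir_sphericalTensor_two hd q hq hq')
  rw [trace_casimir, Matrix.trace_smul, smul_eq_mul, zero_eq_mul] at h
  exact h.resolve_left (by norm_num)

theorem sphericalTensor_two_zero_isHermitian {d : ℕ} :
    (sphericalTensor d 2 0).IsHermitian := by
  ext a b
  rw [Matrix.conjTranspose_apply]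
  by_cases h : a = b
  · subst h
    rw [sphericalTensor, Matrix.of_apply, Complex.star_def, Complex.conj_ofReal]
  · have h' : (a : ℕ) ≠ b := fun e => h (Fin.ext e)
    rw [sphericalTensor_two_apply_of_ne _ _ _ (by omega),
      sphericalTensor_two_apply_of_ne _ _ _ (by omega), star_zero]

theorem sphericalTensor_two_zero_ne_zero {d : ℕ} (hd : 2 < d) : sphericalTensor d 2 0 ≠ 0 := by
  intro h
  have h0 := congrFun (congrFun h ⟨0, by omega⟩) ⟨0, by omega⟩
  rw [sphericalTensor_two_zero hd, Jplus_mul_Jminus, Jminus_mul_Jplus, Jz,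
    Matrix.diagonal_mul_diagonal, Matrix.diagonal_add, ← Matrix.diagonal_smul,
    Matrix.diagonal_sub, ← Matrix.diagonal_smul, Matrix.diagonal_apply_eq, Matrix.zero_apply] at h0
  simp only [Pi.smul_apply, smul_eq_mul, magnetic, spin] at h0
  rw [mul_eq_zero] at h0
  rcases h0 with h0 | h0
  · have := tensorScale_pos hd
    have : -(tensorScale d / 2) = 0 := by exact_mod_cast h0
    linarith
  · have hd' : (2 : ℝ) < d := by exact_mod_cast hd
    -- The top-left entry of the diagonal form is `(d-1) - 4J² = (d-1)(2-d)`; this is where `d > 2`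
    -- is essential.
    have : ((d : ℝ) - 1) * (2 - d) = 0 := by
      have h1 : (((d : ℂ) - 1) * (2 - d)) = 0 := by
        push_cast at h0
        linear_combination h0
      exact_mod_cast h1
    rcases mul_eq_zero.1 this with h1 | h1 <;> linarith

end SpinControl

theorem mainTheorem1 (d : ℕ) (hd : 2 < d) :
    SpinControl.generatedLieAlgebra
        {SpinControl.Jx d, SpinControl.Jy d, SpinControl.sphericalTensor d 2 0} =
      SpinControl.su d ∧
    ∀ h : Matrix (Fin d) (Fin d) ℂ, h.IsHermitian → h.trace = 0 →
      (∃ q : ℤ, -2 ≤ q ∧ q ≤ 2 ∧ (h * SpinControl.sphericalTensor d 2 q).trace ≠ 0) →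
      SpinControl.generatedLieAlgebra {SpinControl.Jx d, SpinControl.Jy d, h} =
        SpinControl.su d := by
  refine ⟨?_, fun h hh ht hq => SpinControl.generatedLieAlgebra_eq_su hd hh ht hq⟩
  have hT : (SpinControl.sphericalTensor d 2 0).IsHermitian :=
    SpinControl.sphericalTensor_two_zero_isHermitian
  refine SpinControl.generatedLieAlgebra_eq_su hd hT
    (SpinControl.trace_sphericalTensor_two hd (by norm_num) (by norm_num))
    ⟨0, by norm_num, by norm_num, ?_⟩
  -- As `T` is Hermitian, `tr (T T) = tr (T T†)`, which vanishes only for `T = 0`.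
  open scoped ComplexOrder in
  nth_rewrite 2 [← hT.eq]
  rw [Ne, Matrix.trace_mul_conjTranspose_self_eq_zero_iff]
  exact SpinControl.sphericalTensor_two_zero_ne_zero hd
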